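/- Let $F(u)=\sum_{k\ge 0}a_ku^k$, where the real power series converges for every $u\in\mathbb R$. Let $\phi:\mathbb R\to\mathbb R$ be Borel measurable, let $\psi:\mathbb R\to\mathbb R$ be locally integrable, and put $$v(x,t)=\tfrac12\int_{x-t}^{x+t}\psi(y)\,dy+\tfrac12\big(\phi(x+t)+\phi(x-t)\big),\qquad \Delta(x,t)=\{(y,s):0\le s\le t,\ |y-x|\le t-s\}.$$ For $0<T\le\infty$, a mild solution on $[0,T)$ of the Cauchy problem $u_{tt}-u_{xx}=F(u)$, $u(\cdot,0)=\phi$, $u_t(\cdot,0)=\psi$, is a measurable function $u:\mathbb R\times[0,T)\to\mathbb R$ such that for all $(x,t)\in\mathbb R\times[0,T)$ the function $F(u)$ is integrable on $\Delta(x,t)$ and $$u(x,t)=v(x,t)+\tfrac12\int_{\Delta(x,t)}F(u(y,s))\,dy\,ds .$$ Let $p=(p_k)_{k\ge0}$ satisfy (i) $p_k\ge 0$, $\sum_kp_k=1$; (ii) $p_k>0$ whenever $a_k\ne0$; (iii) $\sum_{k\ge 1}kp_k\le1$; and let $p_0>0$. Put $w=v/p_0$, $b_k=a_k/p_k$ if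 $p_k\neq 0$ and $b_k=0$ if $p_k=0$, $b_*=\sup_k|b_k|\in[0,\infty]$, and $$T^*=\sup\Big\{t\in[0,\infty]:\ t\le\sqrt{2/b_*}\ \text{ and }\ \sup_{x\in\mathbb R}|w(x,s)|+\tfrac{s^2|b_0|}{2}\le1\ \text{ for all real } s\in[0,t]\Big\}\in[0,\infty],$$ with $\sqrt{2/0}=\infty$, $\sqrt{2/\infty}=0$, $\sup\emptyset=0$. The stochastic cascade started at $(x,t)$ is the following branching process. The root particle is located at $(x,t)$. Each particle, located at $(y,s)$, has a random number $\kappa$ of children with distribution $p$, and chooses, independently of $\kappa$, a point $(\xi,\tau)$ uniformly distributed in $\Delta(y,s)$ (equal to $(y,0)$ if $s=0$); all its children are located at $(\xi,\tau)$, and from there they evolve independently of each other by the same rule. On the event that the family tree is finite, values of particles are defined recursively: a particle at $(y,s)$ without children has the value $w(y,s)+\frac{s^2b_0}{2}$, and a particle at $(y,s)$ with $k\ge1$ children has the value $\frac{s^2}{2}b_k$ times the product of the values of its children. Let $\Pi_\infty(x,t)$ be the value of the root. If $T^*>0$, then the family tree is almost surely finite, $\Pi_\infty(x,t)$ is integrable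 for every $(x,t)\in\mathbb R\times[0,T^*)$, and the Cauchy problem has a unique mild solution on $[0,T^*)$. It is given by $$u(x,t)=\mathsf E\,\Pi_\infty(x,t),\qquad (x,t)\in\mathbb R\times[0,T^*).$$ -/

import Mathlib

open MeasureTheory ProbabilityTheory
open scoped ENNReal

noncomputable section

namespace WaveCascade

/-- The backward light cone `Δ(x,t) = {(y,s) : 0 ≤ s ≤ t, |y - x| ≤ t - s}`, where `z = (x,t)`. -/
def lightCone (z : ℝ × ℝ) : Set (ℝ × ℝ) :=
  {q | 0 ≤ q.2 ∧ q.2 ≤ z.2 ∧ |q.1 - z.1| ≤ z.2 - q.2}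

/-- The solution `v` of the homogeneous linear wave equation with data `φ`, `ψ`. -/
def homSol (φ ψ : ℝ → ℝ) (z : ℝ × ℝ) : ℝ :=
  (1 / 2) * (∫ y in (z.1 - z.2)..(z.1 + z.2), ψ y) + (1 / 2) * (φ (z.1 + z.2) + φ (z.1 - z.2))

/-- The space-time strip `ℝ × [0,T)`, where `T ∈ [0,∞]`. -/
def strip (T : ℝ≥0∞) : Set (ℝ × ℝ) := {z | 0 ≤ z.2 ∧ ENNReal.ofReal z.2 < T}

/-- `u` is a mild solution on `[0,T)` of `u_tt - u_xx = F(u)`, `u(·,0) = φ`, `u_t(·,0) = ψ`.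
Only the values of `u` on `ℝ × [0,T)` matter. -/
structure IsMildSolution (F φ ψ : ℝ → ℝ) (T : ℝ≥0∞) (u : ℝ × ℝ → ℝ) : Prop where
  measurable : Measurable ((strip T).domRestrict u)
  integrableOn : ∀ z ∈ strip T, IntegrableOn (fun q => F (u q)) (lightCone z)
  eq : ∀ z ∈ strip T, u z = homSol φ ψ z + (1 / 2) * ∫ q in lightCone z, F (u q)

/-- The function `w = v / p₀`. -/
def source (p : PMF ℕ) (φ ψ : ℝ → ℝ) (z : ℝ × ℝ) : ℝ := homSol φ ψ z / (p 0).toReal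

/-- The numbers `b_k`: `a_k / p_k` if `p_k ≠ 0`, and `0` otherwise. -/
def coeff (p : PMF ℕ) (a : ℕ → ℝ) (k : ℕ) : ℝ := if p k = 0 then 0 else a k / (p k).toReal

/-- `b_* = sup_k |b_k|`, an element of `[0,∞]`. -/
def coeffSup (p : PMF ℕ) (a : ℕ → ℝ) : ℝ≥0∞ := ⨆ k, ENNReal.ofReal |coeff p a k|

/-- The time `T^*`: the supremum of all `t ≤ √(2 / b_*)` such that
`sup_x |w(x,s)| + s² |b₀| / 2 ≤ 1` for every `s ∈ [0,t]`. It lies in `[0,∞]`, with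
`√(2 / 0) = ∞` and `√(2 / ∞) = 0`, and the supremum of the empty set is `0`. -/
def criticalTime (p : PMF ℕ) (a : ℕ → ℝ) (φ ψ : ℝ → ℝ) : ℝ≥0∞ :=
  sSup {t : ℝ≥0∞ | t ≤ (2 / coeffSup p a) ^ (1 / 2 : ℝ) ∧
    ∀ s : ℝ, 0 ≤ s → ENNReal.ofReal s ≤ t →
      (⨆ x : ℝ, ENNReal.ofReal |source p φ ψ (x, s)|)
        + ENNReal.ofReal (s ^ 2 * |coeff p a 0| / 2) ≤ 1}

/-! ### The stochastic cascade -/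

/-- The uniform distribution on the light cone of `z`. -/
def uniformCone (z : ℝ × ℝ) : Measure (ℝ × ℝ) := volume[|lightCone z]

/-- The affine map of the reference cone `Δ(0,1)` onto the cone `Δ(z)`. -/
def conePoint (z θ : ℝ × ℝ) : ℝ × ℝ := (z.1 + z.2 * θ.1, z.2 * θ.2)

/-- A realization of the random elements of the cascade. The vertex `(a₁,…,aₙ)` of the tree of all
finite sequences carries a number of children and a point of the reference cone `Δ(0,1)`. -/
abbrev Realization : Type := List ℕ → ℕ × (ℝ × ℝ)

/-- The number `κ_∅` of children of the root. -/
def Realization.numChildren (ω : Realization) : ℕ := (ω []).1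

/-- The random point `(ξ_∅,τ_∅)` of the cone of `z` chosen by a root located at `z`. -/
def Realization.point (ω : Realization) (z : ℝ × ℝ) : ℝ × ℝ := conePoint z (ω []).2

/-- The part of the realization that sits on the descendants of the `i`-th child of the root. -/
def Realization.child (ω : Realization) (i : ℕ) : Realization := fun v => ω (i :: v)

/-- Whether a vertex belongs to the Galton-Watson family tree of the realization. -/
def Realization.Mem : Realization → List ℕ → Prop
  | _, [] => True
  | ω, i :: v => i < ω.numChildren ∧ Realization.Mem (ω.child i) v

/-- The Galton-Watson family tree. -/
def Realization.tree (ω : Realization) : Set (List ℕ) := {v | ω.Mem v}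

lemma measurableSet_lightCone (z : ℝ × ℝ) : MeasurableSet (lightCone z) := by
  have h1 : IsClosed {q : ℝ × ℝ | 0 ≤ q.2} := isClosed_le (by fun_prop) (by fun_prop)
  have h2 : IsClosed {q : ℝ × ℝ | q.2 ≤ z.2} := isClosed_le (by fun_prop) (by fun_prop)
  have h3 : IsClosed {q : ℝ × ℝ | |q.1 - z.1| ≤ z.2 - q.2} :=
    isClosed_le (by fun_prop) (by fun_prop)
  have h : IsClosed (lightCone z) := h1.inter (h2.inter h3)
  exact h.measurableSet

lemma volume_lightCone_ne_top (z : ℝ × ℝ) : volume (lightCone z) ≠ ∞ := by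
  refine ne_top_of_le_ne_top (b := volume (Set.Icc ((z.1 - z.2, 0) : ℝ × ℝ) (z.1 + z.2, z.2))) ?_
    (measure_mono ?_)
  · exact isCompact_Icc.measure_lt_top.ne
  · rintro ⟨y, s⟩ ⟨h1, h2, h3⟩
    simp only at h1 h2 h3
    rw [abs_le] at h3
    refine ⟨⟨?_, ?_⟩, ⟨?_, ?_⟩⟩ <;> simp only <;> linarith [h3.1, h3.2]

lemma volume_lightCone_ne_zero {z : ℝ × ℝ} (hz : 0 < z.2) : volume (lightCone z) ≠ 0 := by
  have h : Set.Ioo (z.1 - z.2 / 2) (z.1 + z.2 / 2) ×ˢ Set.Ioo 0 (z.2 / 2) ⊆ lightCone z := by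
    rintro ⟨y, s⟩ ⟨⟨h1, h2⟩, h3, h4⟩
    simp only at h1 h2 h3 h4
    refine ⟨h3.le, by simp only; linarith, ?_⟩
    simp only
    rw [abs_le]
    constructor <;> linarith
  refine (lt_of_lt_of_le ?_ (measure_mono h)).ne'
  refine (isOpen_Ioo.prod isOpen_Ioo).measure_pos volume ⟨(z.1, z.2 / 4), ?_, ?_⟩ <;>
    constructor <;> simp only <;> linarith

lemma isProbabilityMeasure_uniformCone {z : ℝ × ℝ} (hz : 0 < z.2) :
    IsProbabilityMeasure (uniformCone z) :=
  cond_isProbabilityMeasure_of_finite (volume_lightCone_ne_zero hz) (volume_lightCone_ne_top z)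

instance : IsProbabilityMeasure (uniformCone (0, 1)) :=
  isProbabilityMeasure_uniformCone (by norm_num)

/-- If `θ` is uniform in the reference cone, then `conePoint z θ` is uniform in the cone of `z`. -/
lemma map_conePoint {z : ℝ × ℝ} (hz : 0 < z.2) :
    (uniformCone (0, 1)).map (conePoint z) = uniformCone z := by
  have hm : Measurable (conePoint z) := by unfold conePoint; fun_prop
  have hvol : ∀ C : Set (ℝ × ℝ), volume (conePoint z ⁻¹' C)
      = ENNReal.ofReal |(z.2 ^ Module.finrank ℝ (ℝ × ℝ))⁻¹| * volume C := by
    intro C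
    have hpre : conePoint z ⁻¹' C
        = (fun q : ℝ × ℝ => z.2 • q) ⁻¹' ((fun q : ℝ × ℝ => (z.1, (0 : ℝ)) + q) ⁻¹' C) := by
      ext ⟨y, s⟩
      simp [conePoint]
    rw [hpre, Measure.addHaar_preimage_smul volume hz.ne', measure_preimage_add]
  have hcone : conePoint z ⁻¹' lightCone z = lightCone (0, 1) := by
    ext ⟨y, s⟩
    simp only [conePoint, lightCone, Set.mem_preimage, Set.mem_ofPred_eq, add_sub_cancel_left,
      abs_mul, abs_of_pos hz, sub_zero]
    have h : z.2 - z.2 * s = z.2 * (1 - s) := by ring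
    rw [h, mul_le_mul_iff_right₀ hz, mul_nonneg_iff_of_pos_left hz]
    have h' : z.2 * s ≤ z.2 ↔ s ≤ 1 := by
      constructor <;> intro hs <;> nlinarith
    rw [h']
  have := isProbabilityMeasure_uniformCone hz
  have : IsProbabilityMeasure ((uniformCone (0, 1)).map (conePoint z)) :=
    Measure.isProbabilityMeasure_map hm.aemeasurable
  ext B hB
  rw [Measure.map_apply hm hB, uniformCone, uniformCone, cond_apply (measurableSet_lightCone _),
    cond_apply (measurableSet_lightCone _), ← hcone, ← Set.preimage_inter, hvol, hvol,
    ENNReal.mul_inv (Or.inr (volume_lightCone_ne_top z)) (Or.inr (volume_lightCone_ne_zero hz))]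
  have h0 : ENNReal.ofReal |(z.2 ^ Module.finrank ℝ (ℝ × ℝ))⁻¹| ≠ 0 := by
    have : 0 < |(z.2 ^ Module.finrank ℝ (ℝ × ℝ))⁻¹| := by positivity
    exact (ENNReal.ofReal_pos.2 this).ne'
  rw [mul_comm (ENNReal.ofReal _)⁻¹, mul_assoc, ← mul_assoc (ENNReal.ofReal _)⁻¹,
    ENNReal.inv_mul_cancel h0 ENNReal.ofReal_ne_top, one_mul]

/-- The law of the cascade: all vertices carry independent elements, the number of children has
the branching distribution `p`, and the point is uniform in `Δ(0,1)` and independent of it. -/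
def cascadeLaw (p : PMF ℕ) : Measure Realization :=
  Measure.infinitePi fun _ : List ℕ => p.toMeasure.prod (uniformCone (0, 1))

/-- The functional `Π_n(z, g)` of the cascade started at `z = (x,t)` and stopped at generation `n`,
where particles of generation `n` are evaluated by `g`.
A particle at `z = (y,s)` without children contributes `w(y,s) + s² b₀ / 2`. A particle at
`z = (y,s)` with `k ≥ 1` children contributes `(s² / 2) b_k` times the product of the values of its
children, all of which start at the point that it has chosen uniformly in `Δ(y,s)` and then evolve
independently of each other. -/
def stoppedProduct (p : PMF ℕ) (a : ℕ → ℝ) (φ ψ : ℝ → ℝ) (g : ℝ × ℝ → ℝ) :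
    ℕ → ℝ × ℝ → Realization → ℝ
  | 0, z, _ => g z
  | n + 1, z, ω =>
      if ω.numChildren = 0 then source p φ ψ z + z.2 ^ 2 * coeff p a 0 / 2
      else z.2 ^ 2 / 2 * coeff p a ω.numChildren *
        ∏ i ∈ Finset.range ω.numChildren,
          stoppedProduct p a φ ψ g n (ω.point z) (ω.child i)

open Classical in
/-- The functional `Π_∞(z)` of the full cascade started at `z = (x,t)`. If the family tree is
finite, then the recursion is run beyond its last generation, so that every branch ends in a
childless particle. (On infinite trees the value is set to `0`.) -/
def cascadeProduct (p : PMF ℕ) (a : ℕ → ℝ) (φ ψ : ℝ → ℝ) (z : ℝ × ℝ) (ω : Realization) : ℝ :=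
  if h : ω.tree.Finite then
    stoppedProduct p a φ ψ 0 (h.toFinset.sup List.length + 1) z ω
  else 0

/-- The expectation `E Π_∞(z)`. -/
def cascadeMean (p : PMF ℕ) (a : ℕ → ℝ) (φ ψ : ℝ → ℝ) (z : ℝ × ℝ) : ℝ :=
  ∫ ω, cascadeProduct p a φ ψ z ω ∂(cascadeLaw p)

end WaveCascade

end

noncomputable section

namespace WaveCascade

/-! Below `criticalTime` every factor in the cascade has absolute value at most 1: the bound on `w`
and `b₀` controls childless particles, and `t ≤ √(2 / b_*)` controls all others. The backward cone
of a point of the strip stays in the strip, so the whole product is bounded by 1 and its mean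
exists.

The mean solves the equation by conditioning on the first generation. Given `k` children at `q`,
independence turns the product into the `k`-th power of the mean at `q` (`integral_branching`).
Averaging over `k` cancels the factors `p_k` and leaves `v + (t²/2) F` (`hasSum_weight`). Averaging
over `q`, uniform in a cone of area `t²`, turns `t²/2` into half the integral over the cone
(`integral_comp_conePoint`). The recursion needs a finite tree, which is the extinction theorem for
mean offspring at most 1 with `p₀ > 0` (`ae_finite_tree`).

For uniqueness, any mild solution is bounded on each cone because `v` is. There `F` is Lipschitz,
and the difference of two solutions contracts in an exponentially weighted sup norm. -/

/-- The common law of the elements carried by the vertices of the tree. -/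
def vertexLaw (p : PMF ℕ) : Measure (ℕ × (ℝ × ℝ)) := p.toMeasure.prod (uniformCone (0, 1))

instance (p : PMF ℕ) : IsProbabilityMeasure (vertexLaw p) := by unfold vertexLaw; infer_instance

instance (p : PMF ℕ) : IsProbabilityMeasure (cascadeLaw p) := by unfold cascadeLaw; infer_instance

/-! ### The branching property -/

/-- The realization with root element `r` whose children carry the realizations `c i`. -/
def graft (x : (ℕ × (ℝ × ℝ)) × (ℕ → Realization)) : Realization
  | [] => x.1
  | i :: v => x.2 i v

lemma measurable_graft : Measurable graft := by
  refine measurable_pi_lambda _ fun v => ?_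
  cases v with
  | nil => exact measurable_fst
  | cons i v =>
    exact (measurable_pi_apply v).comp ((measurable_pi_apply i).comp measurable_snd)

/-- A product measure is determined by finite boxes. The preimage of a box splits into a condition
on the root and one box for each subtree, since every nonempty vertex is uniquely `i :: v`. -/
lemma map_graft (p : PMF ℕ) :
    ((vertexLaw p).prod (Measure.infinitePi fun _ : ℕ => cascadeLaw p)).map graft
      = cascadeLaw p := by
  classical
  refine Measure.eq_infinitePi _ fun s t ht => ?_
  let S : ℕ → Finset (List ℕ) := fun i => s.preimage (List.cons i) (by simp [Set.InjOn])
  let I : Finset ℕ := s.image List.headI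
  have hS : ∀ i v, v ∈ S i ↔ i :: v ∈ s := fun i v => Finset.mem_preimage
  have hpre : graft ⁻¹' (Set.pi s t) = (if [] ∈ s then t [] else Set.univ) ×ˢ
      Set.pi I (fun i => Set.pi (S i) fun v => t (i :: v)) := by
    ext ⟨r, c⟩
    simp only [Set.mem_preimage, Set.mem_pi, Set.mem_prod, Finset.mem_coe]
    constructor
    · intro h
      refine ⟨?_, fun i _ v hv => h (i :: v) ((hS i v).1 hv)⟩
      split_ifs with h0
      · exact h [] h0
      · trivial
    · rintro ⟨h0, h1⟩ v hv
      cases v with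
      | nil => rw [if_pos hv] at h0; exact h0
      | cons i v =>
        exact h1 i (Finset.mem_image.2 ⟨_, hv, rfl⟩) v ((hS i v).2 hv)
  have hmS : ∀ i, MeasurableSet (Set.pi (S i) fun v => t (i :: v)) := fun i =>
    MeasurableSet.pi (Finset.countable_toSet _) fun v _ => ht _
  rw [Measure.map_apply measurable_graft (MeasurableSet.pi (Finset.countable_toSet _)
    fun v _ => ht v), hpre, Measure.prod_prod, Measure.infinitePi_pi _ fun i _ => hmS i]
  have hin : ∀ i, cascadeLaw p (Set.pi (S i) fun v => t (i :: v))
      = ∏ v ∈ S i, vertexLaw p (t (i :: v)) := fun i =>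
    Measure.infinitePi_pi _ fun v _ => ht _
  simp_rw [hin]
  change _ = ∏ v ∈ s, vertexLaw p (t v)
  have hcons : ∏ i ∈ I, ∏ v ∈ S i, vertexLaw p (t (i :: v))
      = ∏ v ∈ s.erase [], vertexLaw p (t v) := by
    rw [Finset.prod_sigma']
    refine Finset.prod_bij (fun x _ => x.1 :: x.2) ?_ ?_ ?_ ?_
    · rintro ⟨i, v⟩ h
      simp only [Finset.mem_sigma] at h
      exact Finset.mem_erase.2 ⟨List.cons_ne_nil _ _, (hS i v).1 h.2⟩
    · rintro ⟨i, v⟩ _ ⟨j, w⟩ _ h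
      simpa using h
    · rintro v hv
      rw [Finset.mem_erase] at hv
      cases v with
      | nil => exact absurd rfl hv.1
      | cons i v =>
        exact ⟨⟨i, v⟩, Finset.mem_sigma.2 ⟨Finset.mem_image.2 ⟨_, hv.2, rfl⟩,
          (hS i v).2 hv.2⟩, rfl⟩
    · intros; rfl
  rw [hcons]
  split_ifs with h0
  · exact Finset.mul_prod_erase s (fun v => vertexLaw p (t v)) h0
  · rw [measure_univ, one_mul, Finset.erase_eq_of_notMem h0]

lemma integral_infinitePi_prod_range {X : Type*} [MeasurableSpace X] (μ : Measure X)
    [IsProbabilityMeasure μ] {f : X → ℝ} (hf : Measurable f) (k : ℕ) :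
    ∫ c, ∏ i ∈ Finset.range k, f (c i) ∂(Measure.infinitePi fun _ : ℕ => μ)
      = (∫ x, f x ∂μ) ^ k := by
  have h := integral_restrict_infinitePi (μ := fun _ : ℕ => μ) (s := Finset.range k)
    (f := fun y => ∏ i, f (y i)) (by
      refine Measurable.aestronglyMeasurable ?_
      exact Finset.measurable_prod _ fun i _ => hf.comp (measurable_pi_apply i))
  rw [integral_fintype_prod_eq_pow] at h
  simp only [Fintype.card_coe, Finset.card_range] at h
  rw [← h]
  congr 1
  ext c
  exact (Finset.prod_coe_sort (Finset.range k) fun i => f (c i)).symm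

/-- The branching property: given the element of the root, its children are independent copies of
the cascade. -/
lemma integral_branching (p : PMF ℕ) {G : Realization → ℝ} (hG : Integrable G (cascadeLaw p))
    {H : ℕ × (ℝ × ℝ) → ℝ} {f : ℕ × (ℝ × ℝ) → Realization → ℝ} (hf : ∀ r, Measurable (f r))
    (h : ∀ᵐ ω ∂(cascadeLaw p),
      G ω = H (ω []) * ∏ i ∈ Finset.range (ω []).1, f (ω []) (ω.child i)) :
    Integrable (fun r => H r * (∫ ω, f r ω ∂(cascadeLaw p)) ^ r.1) (vertexLaw p) ∧
    ∫ ω, G ω ∂(cascadeLaw p)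
      = ∫ r, H r * (∫ ω, f r ω ∂(cascadeLaw p)) ^ r.1 ∂(vertexLaw p) := by
  set G' : Realization → ℝ :=
    fun ω => H (ω []) * ∏ i ∈ Finset.range (ω []).1, f (ω []) (ω.child i)
  have hG' : Integrable G' (cascadeLaw p) := hG.congr h
  have hmp : MeasurePreserving graft
      ((vertexLaw p).prod (Measure.infinitePi fun _ : ℕ => cascadeLaw p)) (cascadeLaw p) :=
    ⟨measurable_graft, map_graft p⟩
  have hint : Integrable (G' ∘ graft)
      ((vertexLaw p).prod (Measure.infinitePi fun _ : ℕ => cascadeLaw p)) :=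
    hmp.integrable_comp_of_integrable hG'
  have hinner : ∀ r, ∫ c, G' (graft (r, c)) ∂(Measure.infinitePi fun _ : ℕ => cascadeLaw p)
      = H r * (∫ ω, f r ω ∂(cascadeLaw p)) ^ r.1 := by
    intro r
    rw [← integral_infinitePi_prod_range _ (hf r), ← integral_const_mul]
    rfl
  constructor
  · refine hint.integral_prod_left.congr (ae_of_all _ fun r => ?_)
    exact hinner r
  · rw [integral_congr_ae h]
    change ∫ ω, G' ω ∂(cascadeLaw p) = _
    have hG'' := hG'.aestronglyMeasurable
    rw [← map_graft p] at hG''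
    conv_lhs => rw [← map_graft p]
    rw [integral_map measurable_graft.aemeasurable hG'']
    refine (integral_prod _ hint).trans ?_
    exact integral_congr_ae (ae_of_all _ fun r => hinner r)

/-! ### Almost sure finiteness of the family tree -/

lemma measurable_child (i : ℕ) : Measurable fun ω : Realization => ω.child i :=
  measurable_pi_lambda _ fun v => measurable_pi_apply (i :: v)

lemma measurable_numChildren : Measurable Realization.numChildren :=
  measurable_fst.comp (measurable_pi_apply [])

lemma measurableSet_mem (v : List ℕ) : MeasurableSet {ω : Realization | ω.Mem v} := by
  induction v with
  | nil => simp [Realization.Mem]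
  | cons i v ih =>
    exact (measurableSet_lt measurable_const measurable_numChildren).inter
      (measurable_child i ih)

lemma tree_eq (ω : Realization) :
    ω.tree = insert [] (⋃ i ∈ Set.Iio ω.numChildren, List.cons i '' (ω.child i).tree) := by
  ext v
  cases v with
  | nil => simp [Realization.tree, Realization.Mem]
  | cons j v => simp [Realization.tree, Realization.Mem, and_comm]

/-- The realizations whose family tree has no vertex in generation `n`. -/
def extinctAt (n : ℕ) : Set Realization := {ω | ∀ v, ω.Mem v → v.length ≠ n}

lemma measurableSet_extinctAt (n : ℕ) : MeasurableSet (extinctAt n) := by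
  have : extinctAt n = ⋂ v : List ℕ, {ω : Realization | ω.Mem v → v.length ≠ n} := by
    ext; simp [extinctAt]
  rw [this]
  refine MeasurableSet.iInter fun v => ?_
  by_cases h : v.length = n
  · have := (measurableSet_mem v).compl
    simp only [h, ne_eq, not_true_eq_false, imp_false]
    exact this
  · simp [h]

lemma mem_extinctAt_succ {n : ℕ} {ω : Realization} :
    ω ∈ extinctAt (n + 1) ↔ ∀ i < ω.numChildren, ω.child i ∈ extinctAt n := by
  constructor
  · intro h i hi v hv hn
    exact h (i :: v) ⟨hi, hv⟩ (by simp [hn])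
  · rintro h (_ | ⟨i, v⟩) hv hn
    · simp at hn
    · exact h i hv.1 v hv.2 (by simpa using hn)

lemma finite_tree_of_mem_extinctAt {n : ℕ} {ω : Realization} (h : ω ∈ extinctAt n) :
    ω.tree.Finite := by
  induction n generalizing ω with
  | zero => exact absurd rfl (h [] trivial)
  | succ n ih =>
    rw [tree_eq]
    refine Set.Finite.insert _ (Set.Finite.biUnion (Set.finite_Iio _) fun i hi => ?_)
    exact (ih (mem_extinctAt_succ.1 h i hi)).image _

/-- For `k ≥ 1`, factor `1 - s^k = (1 - s)(1 + s + ⋯ + s^(k-1))` and bound each power after the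
first by `s`. Separating `k = 0` is what makes `p₀` appear after averaging. -/
lemma one_sub_pow_le {s : ℝ} (h0 : 0 ≤ s) (h1 : s ≤ 1) (k : ℕ) :
    1 - s ^ k ≤ (1 - s) * ((1 - s) * (if k = 0 then 0 else 1) + s * k) := by
  cases k with
  | zero => simp
  | succ k =>
    rw [if_neg (Nat.succ_ne_zero k)]
    induction k with
    | zero => simp
    | succ k ih =>
      have h2 : s ^ (k + 1) ≤ s := pow_le_of_le_one h0 h1 (Nat.succ_ne_zero k)
      have h3 : (1 - s) * s ^ (k + 1) ≤ (1 - s) * s :=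
        mul_le_mul_of_nonneg_left h2 (by linarith)
      rw [pow_succ]
      push_cast at ih ⊢
      nlinarith

section Extinction

variable {p : PMF ℕ}

lemma lintegral_offspring_le (hpmean : ∑' k : ℕ, (k : ℝ≥0∞) * p k ≤ 1) : ∫⁻ k, (k : ℝ≥0∞) ∂p.toMeasure ≤ 1 := by
  rw [lintegral_countable']
  simpa [PMF.toMeasure_apply_singleton] using hpmean

lemma integrable_offspring (hpmean : ∑' k : ℕ, (k : ℝ≥0∞) * p k ≤ 1) : Integrable (fun k : ℕ => (k : ℝ)) p.toMeasure := by
  refine ⟨(measurable_of_countable _).aestronglyMeasurable, ?_⟩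
  refine lt_of_le_of_lt ?_ (lt_of_le_of_lt (lintegral_offspring_le hpmean) ENNReal.one_lt_top)
  exact lintegral_mono fun k => by simp

lemma integral_offspring_le (hpmean : ∑' k : ℕ, (k : ℝ≥0∞) * p k ≤ 1) : ∫ k, (k : ℝ) ∂p.toMeasure ≤ 1 := by
  rw [integral_eq_lintegral_of_nonneg_ae (ae_of_all _ fun k => by positivity)
    (measurable_of_countable _).aestronglyMeasurable]
  simp only [ENNReal.ofReal_natCast]
  exact ENNReal.toReal_mono ENNReal.one_ne_top (lintegral_offspring_le hpmean)

lemma le_integral_pow_offspring (hpmean : ∑' k : ℕ, (k : ℝ≥0∞) * p k ≤ 1)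
    {s : ℝ} (h0 : 0 ≤ s) (h1 : s ≤ 1) :
    1 - (1 - s) * (1 - (p 0).toReal * (1 - s)) ≤ ∫ k, s ^ k ∂p.toMeasure := by
  have hi : Integrable (fun k : ℕ => if k = 0 then (0 : ℝ) else 1) p.toMeasure :=
    Integrable.of_bound (measurable_of_countable _).aestronglyMeasurable 1
      (ae_of_all _ fun k => by split_ifs <;> simp)
  have hp : Integrable (fun k : ℕ => s ^ k) p.toMeasure :=
    Integrable.of_bound (measurable_of_countable _).aestronglyMeasurable 1
      (ae_of_all _ fun k => by
        rw [Real.norm_eq_abs, abs_of_nonneg (pow_nonneg h0 k)]; exact pow_le_one₀ h0 h1)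
  have hint : Integrable (fun k : ℕ => (1 - s) * ((1 - s) * (if k = 0 then 0 else 1) + s * k))
      p.toMeasure := ((hi.const_mul _).add ((integrable_offspring hpmean).const_mul _)).const_mul _
  have hind : ∫ k : ℕ, (if k = 0 then (0 : ℝ) else 1) ∂p.toMeasure = 1 - (p 0).toReal := by
    have h : (fun k : ℕ => if k = 0 then (0 : ℝ) else 1)
        = fun k => 1 - ({0} : Set ℕ).indicator 1 k := by
      ext k; by_cases hk : k = 0 <;> simp [hk]
    rw [h, integral_sub (integrable_const _)
      ((integrable_const 1).indicator (MeasurableSet.singleton 0)),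
      integral_indicator_one (MeasurableSet.singleton 0)]
    simp [Measure.real, PMF.toMeasure_apply_singleton]
  have h2 := integral_mono ((integrable_const (1 : ℝ)).sub hp) hint fun k => one_sub_pow_le h0 h1 k
  simp only [Pi.sub_apply] at h2
  rw [integral_sub (integrable_const _) hp, integral_const_mul,
    integral_add (hi.const_mul _) ((integrable_offspring hpmean).const_mul _),
    integral_const_mul, integral_const_mul, hind] at h2
  simp only [integral_const, probReal_univ, smul_eq_mul, one_mul] at h2
  have h3 : (1 - s) * (s * ∫ k : ℕ, (k : ℝ) ∂p.toMeasure) ≤ (1 - s) * (s * 1) :=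
    mul_le_mul_of_nonneg_left (mul_le_mul_of_nonneg_left (integral_offspring_le hpmean) h0)
      (by linarith)
  nlinarith

/-- The indicator of extinction is the product of the indicators for the subtrees of the children,
so the branching property yields the generating function recursion. -/
lemma real_extinctAt_succ (n : ℕ) : (cascadeLaw p).real (extinctAt (n + 1))
    = ∫ k, (cascadeLaw p).real (extinctAt n) ^ k ∂p.toMeasure := by
  have hind : ∀ n, ∫ ω, (extinctAt n).indicator (1 : Realization → ℝ) ω ∂(cascadeLaw p)
      = (cascadeLaw p).real (extinctAt n) := fun n =>
    integral_indicator_one (measurableSet_extinctAt n)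
  have h := (integral_branching p (G := (extinctAt (n + 1)).indicator 1) (H := fun _ => 1)
    (f := fun _ => (extinctAt n).indicator 1)
    ((integrable_const 1).indicator (measurableSet_extinctAt _))
    (fun _ => measurable_one.indicator (measurableSet_extinctAt n))
    (ae_of_all _ fun ω => by
      rw [one_mul]
      by_cases hω : ω ∈ extinctAt (n + 1)
      · rw [Set.indicator_of_mem hω]
        refine (Finset.prod_eq_one fun i hi => ?_).symm
        exact Set.indicator_of_mem (mem_extinctAt_succ.1 hω i (Finset.mem_range.1 hi)) _
      · rw [Set.indicator_of_notMem hω]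
        rw [mem_extinctAt_succ] at hω
        push Not at hω
        obtain ⟨i, hi, hω⟩ := hω
        exact (Finset.prod_eq_zero (Finset.mem_range.2 hi)
          (Set.indicator_of_notMem hω _)).symm)).2
  simp only [one_mul] at h
  rw [hind, hind] at h
  rw [h, vertexLaw, integral_fun_fst (fun k : ℕ => (cascadeLaw p).real (extinctAt n) ^ k)]
  simp

/-- A critical or subcritical family tree with `p₀ > 0` is almost surely finite. -/
lemma ae_finite_tree (hpmean : ∑' k : ℕ, (k : ℝ≥0∞) * p k ≤ 1) (hp0 : p 0 ≠ 0) :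
    ∀ᵐ ω ∂(cascadeLaw p), ω.tree.Finite := by
  set q : ℕ → ℝ := fun n => 1 - (cascadeLaw p).real (extinctAt n) with hq
  have hq0 : ∀ n, 0 ≤ q n := fun n => sub_nonneg.2 measureReal_le_one
  have hstep : ∀ n, q (n + 1) ≤ q n * (1 - (p 0).toReal * q n) := by
    intro n
    have := le_integral_pow_offspring hpmean (s := (cascadeLaw p).real (extinctAt n))
      measureReal_nonneg measureReal_le_one
    simp only [hq, real_extinctAt_succ n]
    linarith
  have hpos : 0 < (p 0).toReal := ENNReal.toReal_pos hp0 (p.apply_ne_top 0)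
  have hanti : Antitone q := antitone_nat_of_succ_le fun n => by
    have := hstep n
    have := mul_nonneg hpos.le (mul_nonneg (hq0 n) (hq0 n))
    nlinarith
  have hlim := tendsto_atTop_ciInf hanti ⟨0, by rintro _ ⟨n, rfl⟩; exact hq0 n⟩
  set l := ⨅ n, q n
  -- The limit survival probability inherits the recursive inequality, hence `p₀ l² ≤ 0`.
  have hl : l ≤ l * (1 - (p 0).toReal * l) :=
    le_of_tendsto_of_tendsto' (hlim.comp (Filter.tendsto_add_atTop_nat 1))
      (hlim.mul (tendsto_const_nhds.sub (hlim.const_mul _))) hstep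
  have hl0 : l = 0 := by
    have h : (p 0).toReal * (l * l) ≤ 0 := by linarith
    have h' : l * l ≤ 0 := by
      by_contra hne
      push Not at hne
      exact absurd h (not_le.2 (mul_pos hpos hne))
    exact mul_self_eq_zero.1 (le_antisymm h' (mul_self_nonneg l))
  rw [hl0] at hlim
  rw [ae_iff]
  have hle : ∀ n, (cascadeLaw p).real {ω | ¬ ω.tree.Finite} ≤ q n := by
    intro n
    have : {ω : Realization | ¬ ω.tree.Finite} ⊆ (extinctAt n)ᶜ := fun ω hω h =>
      hω (finite_tree_of_mem_extinctAt h)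
    refine (measureReal_mono this).trans ?_
    rw [probReal_compl_eq_one_sub (measurableSet_extinctAt n)]
  have h0 : (cascadeLaw p).real {ω | ¬ ω.tree.Finite} ≤ 0 := ge_of_tendsto' hlim hle
  exact (measureReal_eq_zero_iff).1 (le_antisymm h0 measureReal_nonneg)

end Extinction

/-! ### Measurability and stabilization of the cascade functional -/

lemma measurable_homSol {φ ψ : ℝ → ℝ} (hφ : Measurable φ) (hψ : LocallyIntegrable ψ volume) :
    Measurable (homSol φ ψ) := by
  have hi : ∀ a b : ℝ, IntervalIntegrable ψ volume a b := fun a b =>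
    (hψ.integrableOn_isCompact isCompact_uIcc).intervalIntegrable
  have hc : Continuous fun x => ∫ y in (0 : ℝ)..x, ψ y :=
    intervalIntegral.continuous_primitive hi 0
  have h : homSol φ ψ = fun z => (1 / 2) * ((∫ y in (0 : ℝ)..(z.1 + z.2), ψ y)
      - ∫ y in (0 : ℝ)..(z.1 - z.2), ψ y) + (1 / 2) * (φ (z.1 + z.2) + φ (z.1 - z.2)) := by
    ext z
    rw [homSol, intervalIntegral.integral_interval_sub_left (hi _ _) (hi _ _)]
  rw [h]
  have h1 : Measurable fun z : ℝ × ℝ => z.1 + z.2 := by fun_prop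
  have h2 : Measurable fun z : ℝ × ℝ => z.1 - z.2 := by fun_prop
  exact (((hc.measurable.comp h1).sub (hc.measurable.comp h2)).const_mul _).add
    (((hφ.comp h1).add (hφ.comp h2)).const_mul _)

lemma measurable_source (p : PMF ℕ) {φ ψ : ℝ → ℝ} (hφ : Measurable φ)
    (hψ : LocallyIntegrable ψ volume) : Measurable (source p φ ψ) :=
  (measurable_homSol hφ hψ).div_const _

lemma measurable_stoppedProduct (p : PMF ℕ) (a : ℕ → ℝ) {φ ψ : ℝ → ℝ} (hφ : Measurable φ)
    (hψ : LocallyIntegrable ψ volume) (n : ℕ) :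
    Measurable fun x : (ℝ × ℝ) × Realization => stoppedProduct p a φ ψ 0 n x.1 x.2 := by
  induction n with
  | zero => exact measurable_const
  | succ n ih =>
    have hN : Measurable fun x : (ℝ × ℝ) × Realization => x.2.numChildren :=
      measurable_numChildren.comp measurable_snd
    have hpt : Measurable fun x : (ℝ × ℝ) × Realization => x.2.point x.1 := by
      have h0 : Measurable fun x : (ℝ × ℝ) × Realization => (x.2 []).2 :=
        measurable_snd.comp ((measurable_pi_apply []).comp measurable_snd)
      unfold Realization.point conePoint
      fun_prop
    -- The product has random length: measurability is checked for each fixed `k` and glued over the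
    -- countable set of values.
    have hk : ∀ k : ℕ, Measurable fun x : (ℝ × ℝ) × Realization =>
        if k = 0 then source p φ ψ x.1 + x.1.2 ^ 2 * coeff p a 0 / 2
        else x.1.2 ^ 2 / 2 * coeff p a k * ∏ i ∈ Finset.range k,
          stoppedProduct p a φ ψ 0 n (x.2.point x.1) (x.2.child i) := by
      intro k
      have h2 : Measurable fun x : (ℝ × ℝ) × Realization => x.1.2 := by fun_prop
      refine Measurable.ite (by simp) ?_ ?_
      · exact ((measurable_source p hφ hψ).comp measurable_fst).add
          (((h2.pow_const 2).mul_const _).div_const _)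
      · refine (((h2.pow_const 2).div_const _).mul_const _).mul
          (Finset.measurable_prod _ fun i _ => ?_)
        exact ih.comp (hpt.prodMk ((measurable_child i).comp measurable_snd))
    exact (measurable_from_prod_countable_right (f := fun y : ℕ × ((ℝ × ℝ) × Realization) =>
        if y.1 = 0 then source p φ ψ y.2.1 + y.2.1.2 ^ 2 * coeff p a 0 / 2
        else y.2.1.2 ^ 2 / 2 * coeff p a y.1 * ∏ i ∈ Finset.range y.1,
          stoppedProduct p a φ ψ 0 n (y.2.2.point y.2.1) (y.2.2.child i)) hk).comp
        (hN.prodMk measurable_id)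

/-- There are only countably many finite sets of vertices that could contain the tree. -/
lemma measurableSet_finite_tree : MeasurableSet {ω : Realization | ω.tree.Finite} := by
  have : {ω : Realization | ω.tree.Finite}
      = ⋃ s : Finset (List ℕ), ⋂ v : List ℕ, {ω : Realization | ω.Mem v → v ∈ s} := by
    ext ω
    simp only [Set.mem_ofPred_eq, Set.mem_iUnion, Set.mem_iInter]
    constructor
    · exact fun h => ⟨h.toFinset, fun v hv => h.mem_toFinset.2 hv⟩
    · rintro ⟨s, hs⟩
      exact s.finite_toSet.subset fun v hv => hs v hv
  rw [this]
  refine MeasurableSet.iUnion fun s => MeasurableSet.iInter fun v => ?_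
  by_cases h : v ∈ s
  · simp [h]
  · have := (measurableSet_mem v).compl
    simp only [h, imp_false]
    exact this

/-- Every branch ends in a childless particle before generation `n`, so the stopping values `g`
never enter. -/
lemma stoppedProduct_eq_of_length_lt (p : PMF ℕ) (a : ℕ → ℝ) (φ ψ : ℝ → ℝ) (g : ℝ × ℝ → ℝ)
    {n m : ℕ} (hnm : n ≤ m) {ω : Realization} (h : ∀ v ∈ ω.tree, v.length < n) (z : ℝ × ℝ) :
    stoppedProduct p a φ ψ g m z ω = stoppedProduct p a φ ψ g n z ω := by
  induction n generalizing m ω z with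
  | zero => exact absurd (h [] trivial) (Nat.not_lt_zero _)
  | succ n ih =>
    obtain ⟨m, rfl⟩ : ∃ k, m = k + 1 := ⟨m - 1, by omega⟩
    simp only [stoppedProduct]
    split_ifs with h0
    · rfl
    · congr 1
      refine Finset.prod_congr rfl fun i hi => ih (by omega) (fun v hv => ?_) _
      have := h (i :: v) ⟨Finset.mem_range.1 hi, hv⟩
      simpa using this

lemma eventually_stoppedProduct_eq (p : PMF ℕ) (a : ℕ → ℝ) (φ ψ : ℝ → ℝ) {ω : Realization}
    (h : ω.tree.Finite) (z : ℝ × ℝ) :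
    ∀ᶠ n in Filter.atTop, stoppedProduct p a φ ψ 0 n z ω = cascadeProduct p a φ ψ z ω := by
  filter_upwards [Filter.eventually_ge_atTop (h.toFinset.sup List.length + 1)] with n hn
  rw [cascadeProduct, dif_pos h]
  refine stoppedProduct_eq_of_length_lt p a φ ψ 0 hn (fun v hv => ?_) z
  exact Nat.lt_succ_of_le (Finset.le_sup (f := List.length) (h.mem_toFinset.2 hv))

lemma measurable_cascadeProduct (p : PMF ℕ) (a : ℕ → ℝ) {φ ψ : ℝ → ℝ} (hφ : Measurable φ)
    (hψ : LocallyIntegrable ψ volume) :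
    Measurable fun x : (ℝ × ℝ) × Realization => cascadeProduct p a φ ψ x.1 x.2 := by
  have hset : MeasurableSet {x : (ℝ × ℝ) × Realization | x.2.tree.Finite} :=
    measurable_snd measurableSet_finite_tree
  refine measurable_of_tendsto_metrizable
    (f := fun n => {x : (ℝ × ℝ) × Realization | x.2.tree.Finite}.indicator
      fun x => stoppedProduct p a φ ψ 0 n x.1 x.2)
    (fun n => (measurable_stoppedProduct p a hφ hψ n).indicator hset) ?_
  rw [tendsto_pi_nhds]
  intro x
  by_cases hx : x.2.tree.Finite
  · refine tendsto_const_nhds.congr' ?_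
    filter_upwards [eventually_stoppedProduct_eq p a φ ψ hx x.1] with n hn
    rw [Set.indicator_of_mem (show x ∈ {x : (ℝ × ℝ) × Realization | x.2.tree.Finite} from hx), hn]
  · have h0 : cascadeProduct p a φ ψ x.1 x.2 = 0 := by rw [cascadeProduct, dif_neg hx]
    rw [h0]
    refine tendsto_const_nhds.congr fun n => ?_
    rw [Set.indicator_of_notMem (show x ∉ {x : (ℝ × ℝ) × Realization | x.2.tree.Finite} from hx)]

/-! ### Recursion and uniform bound for the full product -/

/-- The weight that a particle at `z` with `k` children contributes to the product. -/
def weight (p : PMF ℕ) (a : ℕ → ℝ) (φ ψ : ℝ → ℝ) (z : ℝ × ℝ) (k : ℕ) : ℝ :=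
  if k = 0 then source p φ ψ z + z.2 ^ 2 * coeff p a 0 / 2 else z.2 ^ 2 / 2 * coeff p a k

lemma stoppedProduct_succ (p : PMF ℕ) (a : ℕ → ℝ) (φ ψ : ℝ → ℝ) (g : ℝ × ℝ → ℝ) (n : ℕ)
    (z : ℝ × ℝ) (ω : Realization) :
    stoppedProduct p a φ ψ g (n + 1) z ω = weight p a φ ψ z ω.numChildren *
      ∏ i ∈ Finset.range ω.numChildren,
        stoppedProduct p a φ ψ g n (ω.point z) (ω.child i) := by
  rw [stoppedProduct, weight]
  split_ifs with h
  · simp [h]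
  · rfl

lemma finite_tree_child {ω : Realization} (h : ω.tree.Finite) {i : ℕ} (hi : i < ω.numChildren) :
    (ω.child i).tree.Finite :=
  Set.Finite.of_finite_image (f := List.cons i)
    (h.subset (by rintro _ ⟨v, hv, rfl⟩; exact ⟨hi, hv⟩)) (by simp [Set.InjOn])

/-- The tree and its subtrees are truncated at different levels; one level large enough for the root
and its finitely many children reduces this to the stopped recursion. -/
lemma cascadeProduct_eq (p : PMF ℕ) (a : ℕ → ℝ) (φ ψ : ℝ → ℝ) {ω : Realization}
    (h : ω.tree.Finite) (z : ℝ × ℝ) :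
    cascadeProduct p a φ ψ z ω = weight p a φ ψ z ω.numChildren *
      ∏ i ∈ Finset.range ω.numChildren, cascadeProduct p a φ ψ (ω.point z) (ω.child i) := by
  have h1 := (Filter.tendsto_add_atTop_nat 1).eventually
    (eventually_stoppedProduct_eq p a φ ψ h z)
  have h2 : ∀ᶠ n in Filter.atTop, ∀ i ∈ Finset.range ω.numChildren,
      stoppedProduct p a φ ψ 0 n (ω.point z) (ω.child i)
        = cascadeProduct p a φ ψ (ω.point z) (ω.child i) :=
    (Finset.eventually_all _).2 fun i hi => eventually_stoppedProduct_eq p a φ ψ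
      (finite_tree_child h (Finset.mem_range.1 hi)) _
  obtain ⟨n, hn1, hn2⟩ := (h1.and h2).exists
  rw [← hn1, stoppedProduct_succ, Finset.prod_congr rfl hn2]

lemma conePoint_mem_lightCone {z θ : ℝ × ℝ} (hz : 0 ≤ z.2) (hθ : θ ∈ lightCone (0, 1)) :
    conePoint z θ ∈ lightCone z := by
  obtain ⟨h1, h2, h3⟩ := hθ
  simp only [sub_zero] at h1 h2 h3
  refine ⟨mul_nonneg hz h1, mul_le_of_le_one_right hz h2, ?_⟩
  simp only [conePoint, add_sub_cancel_left, abs_mul, abs_of_nonneg hz]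
  nlinarith

/-- Since `S` contains the cone of each of its points, the cascade never leaves the region where the
weights are bounded by 1. -/
lemma abs_stoppedProduct_le_one (p : PMF ℕ) (a : ℕ → ℝ) (φ ψ : ℝ → ℝ) {S : Set (ℝ × ℝ)}
    (hS : ∀ z ∈ S, 0 ≤ z.2 ∧ lightCone z ⊆ S) (hw : ∀ z ∈ S, ∀ k, |weight p a φ ψ z k| ≤ 1)
    {ω : Realization} (hω : ∀ v, (ω v).2 ∈ lightCone (0, 1)) (n : ℕ) {z : ℝ × ℝ} (hz : z ∈ S) :
    |stoppedProduct p a φ ψ 0 n z ω| ≤ 1 := by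
  induction n generalizing z ω with
  | zero => simp [stoppedProduct]
  | succ n ih =>
    rw [stoppedProduct_succ, abs_mul, Finset.abs_prod]
    refine mul_le_one₀ (hw z hz _) (Finset.prod_nonneg fun _ _ => abs_nonneg _)
      (Finset.prod_le_one (fun _ _ => abs_nonneg _) fun i _ => ?_)
    exact ih (fun v => hω (i :: v))
      ((hS z hz).2 (conePoint_mem_lightCone (hS z hz).1 (hω [])))

lemma ae_uniformCone_mem (z : ℝ × ℝ) : ∀ᵐ q ∂(uniformCone z), q ∈ lightCone z :=
  ae_cond_mem (measurableSet_lightCone z)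

lemma ae_point_mem (p : PMF ℕ) :
    ∀ᵐ ω ∂(cascadeLaw p), ∀ v, (ω v).2 ∈ lightCone (0, 1) := by
  rw [ae_all_iff]
  intro v
  have h1 : ∀ᵐ r ∂(vertexLaw p), r.2 ∈ lightCone (0, 1) := by
    have : MeasurePreserving Prod.snd (vertexLaw p) (uniformCone (0, 1)) :=
      measurePreserving_snd
    exact this.quasiMeasurePreserving.ae (ae_uniformCone_mem _)
  have h2 : MeasurePreserving (Function.eval v) (cascadeLaw p) (vertexLaw p) :=
    measurePreserving_eval_infinitePi (fun _ : List ℕ => vertexLaw p) v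
  exact h2.quasiMeasurePreserving.ae h1

lemma ae_abs_cascadeProduct_le_one (p : PMF ℕ) (a : ℕ → ℝ) (φ ψ : ℝ → ℝ) {S : Set (ℝ × ℝ)}
    (hS : ∀ z ∈ S, 0 ≤ z.2 ∧ lightCone z ⊆ S) (hw : ∀ z ∈ S, ∀ k, |weight p a φ ψ z k| ≤ 1) :
    ∀ᵐ ω ∂(cascadeLaw p), ∀ z ∈ S, |cascadeProduct p a φ ψ z ω| ≤ 1 := by
  filter_upwards [ae_point_mem p] with ω hω z hz
  rw [cascadeProduct]
  split_ifs with h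
  · exact abs_stoppedProduct_le_one p a φ ψ hS hw hω _ hz
  · simp

/-! ### Geometry of light cones -/

lemma volume_lightCone {z : ℝ × ℝ} (hz : 0 ≤ z.2) :
    volume (lightCone z) = ENNReal.ofReal (z.2 ^ 2) := by
  rw [Measure.volume_eq_prod, Measure.prod_apply_symm (measurableSet_lightCone z)]
  have hslice : ∀ s : ℝ, volume ((fun y : ℝ => (y, s)) ⁻¹' lightCone z)
      = (Set.Icc 0 z.2).indicator (fun s => ENNReal.ofReal (2 * (z.2 - s))) s := by
    intro s
    by_cases hs : s ∈ Set.Icc 0 z.2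
    · have : (fun y : ℝ => (y, s)) ⁻¹' lightCone z
          = Set.Icc (z.1 - (z.2 - s)) (z.1 + (z.2 - s)) := by
        ext y
        simp only [lightCone, Set.mem_preimage, Set.mem_ofPred_eq, hs.1, hs.2, true_and,
          Set.mem_Icc, abs_le]
        constructor <;> rintro ⟨h1, h2⟩ <;> constructor <;> linarith
      rw [Set.indicator_of_mem hs, this, Real.volume_Icc]
      congr 1
      ring
    · have : (fun y : ℝ => (y, s)) ⁻¹' lightCone z = ∅ := by
        ext y
        simp only [lightCone, Set.mem_preimage, Set.mem_ofPred_eq, Set.mem_empty_iff_false,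
          iff_false]
        exact fun h => hs ⟨h.1, h.2.1⟩
      rw [Set.indicator_of_notMem hs, this, measure_empty]
  have hc : Continuous fun s : ℝ => 2 * (z.2 - s) := by fun_prop
  simp_rw [hslice]
  rw [lintegral_indicator measurableSet_Icc, ← ofReal_integral_eq_lintegral_ofReal
    hc.continuousOn.integrableOn_Icc
    ((ae_restrict_iff' measurableSet_Icc).2 (ae_of_all _ fun s hs => by
      simp only [Pi.zero_apply]; linarith [hs.2])),
    integral_Icc_eq_integral_Ioc, ← intervalIntegral.integral_of_le hz]
  congr 1
  have hderiv : ∀ s ∈ Set.uIcc 0 z.2, HasDerivAt (fun s => 2 * z.2 * s - s ^ 2) (2 * (z.2 - s)) s :=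
    fun s _ => by
      have := ((hasDerivAt_id s).const_mul (2 * z.2)).sub (hasDerivAt_pow 2 s)
      convert! this using 1
      simp
      ring
  rw [intervalIntegral.integral_eq_sub_of_hasDerivAt hderiv (hc.intervalIntegrable _ _)]
  ring

lemma lightCone_subset_lightCone {z q : ℝ × ℝ} (hq : q ∈ lightCone z) :
    lightCone q ⊆ lightCone z := by
  rintro r ⟨h1, h2, h3⟩
  obtain ⟨g1, g2, g3⟩ := hq
  refine ⟨h1, h2.trans g2, ?_⟩
  have := abs_sub_le r.1 q.1 z.1
  linarith

lemma self_mem_lightCone {z : ℝ × ℝ} (hz : 0 ≤ z.2) : z ∈ lightCone z := ⟨hz, le_rfl, by simp⟩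

lemma lightCone_subset_strip {T : ℝ≥0∞} {z : ℝ × ℝ} (hz : z ∈ strip T) :
    lightCone z ⊆ strip T := fun _ hq =>
  ⟨hq.1, (ENNReal.ofReal_le_ofReal hq.2.1).trans_lt hz.2⟩

/-! ### Bounds below the critical time -/

section CriticalTime

variable {p : PMF ℕ} {a : ℕ → ℝ} {φ ψ : ℝ → ℝ} {z : ℝ × ℝ}

lemma sq_mul_coeff_le_one (hz : z ∈ strip (criticalTime p a φ ψ)) (k : ℕ) :
    z.2 ^ 2 / 2 * |coeff p a k| ≤ 1 := by
  -- Being strictly below the supremum gives an admissible `t` above `z.2`. The computation stays in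
  -- `[0,∞]` to cover `b_* = 0` and `b_* = ∞`.
  obtain ⟨t, ⟨ht, -⟩, hzt⟩ := lt_sSup_iff.1 hz.2
  have h1 : ENNReal.ofReal z.2 ≤ (2 / coeffSup p a) ^ (1 / 2 : ℝ) := hzt.le.trans ht
  have h2 : ENNReal.ofReal z.2 ^ 2 ≤ 2 / coeffSup p a := by
    have := pow_le_pow_left' h1 2
    rwa [← ENNReal.rpow_natCast, ← ENNReal.rpow_natCast, ← ENNReal.rpow_mul, Nat.cast_ofNat,
      one_div, inv_mul_cancel₀ two_ne_zero, ENNReal.rpow_one, ← Nat.cast_ofNat,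
      ENNReal.rpow_natCast] at this
  have h3 : ENNReal.ofReal z.2 ^ 2 * ENNReal.ofReal |coeff p a k| ≤ 2 :=
    ENNReal.mul_le_of_le_div (h2.trans (ENNReal.div_le_div_left
      (le_iSup (fun k => ENNReal.ofReal |coeff p a k|) k) _))
  rw [← ENNReal.ofReal_pow hz.1, ← ENNReal.ofReal_mul (by positivity),
    ← ENNReal.ofReal_ofNat 2, ENNReal.ofReal_le_ofReal_iff (by norm_num)] at h3
  linarith

lemma abs_source_add_le_one (hz : z ∈ strip (criticalTime p a φ ψ)) :
    |source p φ ψ z| + z.2 ^ 2 * |coeff p a 0| / 2 ≤ 1 := by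
  obtain ⟨t, ⟨-, ht⟩, hzt⟩ := lt_sSup_iff.1 hz.2
  have h := ht z.2 hz.1 hzt.le
  have h' : ENNReal.ofReal |source p φ ψ z| + ENNReal.ofReal (z.2 ^ 2 * |coeff p a 0| / 2) ≤ 1 :=
    (add_le_add_left (le_iSup (fun x => ENNReal.ofReal |source p φ ψ (x, z.2)|) z.1) _).trans h
  rwa [← ENNReal.ofReal_add (abs_nonneg _) (by positivity), ENNReal.ofReal_le_one] at h'

lemma abs_weight_le_one (hz : z ∈ strip (criticalTime p a φ ψ)) (k : ℕ) :
    |weight p a φ ψ z k| ≤ 1 := by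
  rw [weight]
  split_ifs with hk
  · refine (abs_add_le _ _).trans ?_
    have := abs_source_add_le_one hz
    rwa [abs_div, abs_mul, abs_of_nonneg (sq_nonneg z.2), abs_of_pos (two_pos (α := ℝ))]
  · rw [abs_mul, abs_of_nonneg (by positivity)]
    exact sq_mul_coeff_le_one hz k

lemma abs_homSol_le_one (hp0 : p 0 ≠ 0) (hz : z ∈ strip (criticalTime p a φ ψ)) :
    |homSol φ ψ z| ≤ 1 := by
  have hpos : 0 < (p 0).toReal := ENNReal.toReal_pos hp0 (p.apply_ne_top 0)
  have hle : (p 0).toReal ≤ 1 := ENNReal.toReal_mono ENNReal.one_ne_top (p.coe_le_one 0)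
  have h1 : |source p φ ψ z| ≤ 1 := by
    have := abs_source_add_le_one hz
    have : 0 ≤ z.2 ^ 2 * |coeff p a 0| / 2 := by positivity
    linarith
  rw [source, abs_div, abs_of_pos hpos, div_le_one hpos] at h1
  exact h1.trans hle

end CriticalTime

/-! ### Local bounds for the nonlinearity -/

section PowerSeries

variable {F : ℝ → ℝ} {a : ℕ → ℝ}

lemma measurable_of_hasSum_pow (hF : ∀ u : ℝ, HasSum (fun k => a k * u ^ k) (F u)) :
    Measurable F :=
  measurable_of_tendsto_metrizable
    (f := fun n u => ∑ k ∈ Finset.range n, a k * u ^ k)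
    (fun _ => Finset.measurable_fun_sum _ fun k _ => (measurable_id.pow_const k).const_mul _)
    (tendsto_pi_nhds.2 fun u => (hF u).tendsto_sum_nat)

lemma summable_abs_mul_pow (hF : ∀ u : ℝ, HasSum (fun k => a k * u ^ k) (F u)) {M : ℝ}
    (hM : 0 ≤ M) : Summable fun k => |a k| * M ^ k :=
  (hF M).summable.abs.congr fun k => by rw [abs_mul, abs_of_nonneg (pow_nonneg hM k)]

/-- An everywhere convergent power series is Lipschitz on bounded sets. -/
lemma exists_lipschitz_of_hasSum_pow (hF : ∀ u : ℝ, HasSum (fun k => a k * u ^ k) (F u))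
    {M : ℝ} (hM : 1 ≤ M) :
    ∃ L, 0 ≤ L ∧ ∀ x y, |x| ≤ M → |y| ≤ M → |F x - F y| ≤ L * |x - y| := by
  -- The radius `2M` absorbs the factor `k ≤ 2^k` from differentiating `u^k`; `M ≥ 1` allows
  -- `M^(k-1) ≤ M^k`.
  have hs := summable_abs_mul_pow hF (M := 2 * M) (by linarith)
  refine ⟨∑' k, |a k| * (2 * M) ^ k, tsum_nonneg fun k => by positivity, fun x y hx hy => ?_⟩
  have hxy := ((hF x).sub (hF y))
  rw [← hxy.tsum_eq, ← tsum_mul_right]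
  have hterm : ∀ k, ‖a k * x ^ k - a k * y ^ k‖ ≤ |a k| * (2 * M) ^ k * |x - y| := by
    intro k
    rw [Real.norm_eq_abs, ← mul_sub, abs_mul, mul_assoc]
    refine mul_le_mul_of_nonneg_left ?_ (abs_nonneg _)
    refine (abs_pow_sub_pow_le x y k).trans ?_
    rw [mul_assoc, mul_comm]
    refine mul_le_mul_of_nonneg_right ?_ (abs_nonneg _)
    rw [mul_pow]
    have h1 : (k : ℝ) ≤ 2 ^ k := by exact_mod_cast Nat.lt_two_pow_self.le
    have h2 : max |x| |y| ^ (k - 1) ≤ M ^ k :=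
      (pow_le_pow_left₀ (le_max_of_le_left (abs_nonneg _)) (max_le hx hy) _).trans
        (pow_le_pow_right₀ hM (Nat.sub_le _ _))
    exact mul_le_mul h1 h2 (pow_nonneg (le_max_of_le_left (abs_nonneg _)) _) (by positivity)
  exact tsum_of_norm_bounded ((hs.mul_right _).hasSum) hterm

lemma exists_bound_of_hasSum_pow (hF : ∀ u : ℝ, HasSum (fun k => a k * u ^ k) (F u))
    {M : ℝ} (hM : 0 ≤ M) : ∃ C, ∀ x, |x| ≤ M → |F x| ≤ C := by
  refine ⟨∑' k, |a k| * M ^ k, fun x hx => ?_⟩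
  rw [← (hF x).tsum_eq, ← Real.norm_eq_abs]
  refine tsum_of_norm_bounded (summable_abs_mul_pow hF hM).hasSum fun k => ?_
  rw [Real.norm_eq_abs, abs_mul, abs_pow]
  exact mul_le_mul_of_nonneg_left (pow_le_pow_left₀ (abs_nonneg _) hx k) (abs_nonneg _)

end PowerSeries

/-! ### The mean of the cascade is a mild solution -/

section Mean

variable {p : PMF ℕ} {a : ℕ → ℝ} {φ ψ : ℝ → ℝ} {z : ℝ × ℝ}

lemma measurable_cascadeMean (p : PMF ℕ) (a : ℕ → ℝ) (hφ : Measurable φ)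
    (hψ : LocallyIntegrable ψ volume) : Measurable (cascadeMean p a φ ψ) :=
  (StronglyMeasurable.integral_prod_right
    (measurable_cascadeProduct p a hφ hψ).stronglyMeasurable).measurable

lemma ae_abs_cascadeProduct_le_one_of_mem_strip (hz : z ∈ strip (criticalTime p a φ ψ)) :
    ∀ᵐ ω ∂(cascadeLaw p), |cascadeProduct p a φ ψ z ω| ≤ 1 := by
  filter_upwards [ae_abs_cascadeProduct_le_one p a φ ψ
    (S := strip (criticalTime p a φ ψ)) (fun q hq => ⟨hq.1, lightCone_subset_strip hq⟩)
    fun q hq => abs_weight_le_one hq] with ω hω using hω z hz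

lemma integrable_cascadeProduct (hφ : Measurable φ) (hψ : LocallyIntegrable ψ volume)
    (hz : z ∈ strip (criticalTime p a φ ψ)) :
    Integrable (cascadeProduct p a φ ψ z) (cascadeLaw p) :=
  Integrable.of_bound ((measurable_cascadeProduct p a hφ hψ).comp
    measurable_prodMk_left).aestronglyMeasurable 1 (ae_abs_cascadeProduct_le_one_of_mem_strip hz)

lemma abs_cascadeMean_le_one (hz : z ∈ strip (criticalTime p a φ ψ)) :
    |cascadeMean p a φ ψ z| ≤ 1 := by
  have := norm_integral_le_of_norm_le_const (μ := cascadeLaw p)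
    (f := cascadeProduct p a φ ψ z) (C := 1) (ae_abs_cascadeProduct_le_one_of_mem_strip hz)
  simpa [cascadeMean] using this

/-- The factor `p_k` cancels the denominators of `b_k` and `w`. When `p_k = 0`, the hypothesis on
`a` forces `a_k = 0`, so `p_k b_k = a_k` still holds. -/
lemma hasSum_weight {F : ℝ → ℝ} (hF : ∀ u : ℝ, HasSum (fun k => a k * u ^ k) (F u))
    (hp0 : p 0 ≠ 0) (hpa : ∀ k, a k ≠ 0 → p k ≠ 0) (z : ℝ × ℝ) (u : ℝ) :
    HasSum (fun k => (p k).toReal * (weight p a φ ψ z k * u ^ k))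
      (homSol φ ψ z + z.2 ^ 2 / 2 * F u) := by
  have hpk : ∀ k, p k ≠ 0 → (p k).toReal ≠ 0 := fun k hk =>
    (ENNReal.toReal_pos hk (p.apply_ne_top k)).ne'
  have hc : ∀ k, (p k).toReal * coeff p a k = a k := by
    intro k
    rw [coeff]
    split_ifs with h
    · rw [mul_zero]
      by_contra hne
      exact hpa k (Ne.symm hne) h
    · exact mul_div_cancel₀ _ (hpk k h)
  have h := (hasSum_ite_eq 0 (homSol φ ψ z)).add ((hF u).mul_left (z.2 ^ 2 / 2))
  convert! h using 2 with k
  rw [weight]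
  split_ifs with hk
  · subst hk
    rw [source, pow_zero, ← hc 0]
    field_simp [hpk 0 hp0]
  · rw [← hc k]
    ring

/-- Conditioning on the first generation of the cascade. -/
lemma cascadeMean_eq_integral {F : ℝ → ℝ} (hF : ∀ u : ℝ, HasSum (fun k => a k * u ^ k) (F u))
    (hφ : Measurable φ) (hψ : LocallyIntegrable ψ volume) (hp0 : p 0 ≠ 0)
    (hpa : ∀ k, a k ≠ 0 → p k ≠ 0) (hpmean : ∑' k : ℕ, (k : ℝ≥0∞) * p k ≤ 1)
    (hz : z ∈ strip (criticalTime p a φ ψ)) :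
    cascadeMean p a φ ψ z = ∫ θ, (homSol φ ψ z
      + z.2 ^ 2 / 2 * F (cascadeMean p a φ ψ (conePoint z θ))) ∂(uniformCone (0, 1)) := by
  obtain ⟨hint, heq⟩ := integral_branching p (integrable_cascadeProduct hφ hψ hz)
    (H := fun r => weight p a φ ψ z r.1)
    (f := fun r => cascadeProduct p a φ ψ (conePoint z r.2))
    (fun r => (measurable_cascadeProduct p a hφ hψ).comp measurable_prodMk_left)
    (by
      filter_upwards [ae_finite_tree hpmean hp0] with ω hω
      exact cascadeProduct_eq p a φ ψ hω z)
  rw [cascadeMean, heq]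
  -- With the chosen point as outer variable, the inner average over the number of children is the
  -- series of `hasSum_weight`.
  refine (integral_prod_symm _ hint).trans (integral_congr_ae ?_)
  filter_upwards [ae_uniformCone_mem (0, 1)] with θ hθ
  have hu := abs_cascadeMean_le_one
    (lightCone_subset_strip hz (conePoint_mem_lightCone hz.1 hθ))
  rw [PMF.integral_eq_tsum]
  · exact (hasSum_weight hF hp0 hpa z (cascadeMean p a φ ψ (conePoint z θ))).tsum_eq
  · refine Integrable.of_bound (measurable_of_countable _).aestronglyMeasurable 1
      (ae_of_all _ fun k => ?_)
    rw [Real.norm_eq_abs, abs_mul, abs_pow]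
    exact mul_le_one₀ (abs_weight_le_one hz k) (by positivity)
      (pow_le_one₀ (abs_nonneg _) hu)

/-- The area `t²` cancels the normalization of the uniform law. At `t = 0` the cone is null and both
sides vanish. -/
lemma integral_comp_conePoint {f : ℝ × ℝ → ℝ} (hf : Measurable f) (hz : 0 ≤ z.2) :
    z.2 ^ 2 * ∫ θ, f (conePoint z θ) ∂(uniformCone (0, 1)) = ∫ q in lightCone z, f q := by
  rcases hz.eq_or_lt with h0 | hpos
  · have h : volume (lightCone z) = 0 := by rw [volume_lightCone hz, ← h0]; simp
    rw [Measure.restrict_eq_zero.2 h, ← h0]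
    simp
  · have hm : Measurable (conePoint z) := by unfold conePoint; fun_prop
    rw [← integral_map hm.aemeasurable hf.aestronglyMeasurable, map_conePoint hpos, uniformCone,
      ProbabilityTheory.cond, integral_smul_measure, volume_lightCone hz, ENNReal.toReal_inv,
      ENNReal.toReal_ofReal (sq_nonneg _), smul_eq_mul, mul_inv_cancel_left₀ (by positivity)]

lemma isMildSolution_cascadeMean {F : ℝ → ℝ}
    (hF : ∀ u : ℝ, HasSum (fun k => a k * u ^ k) (F u))
    (hφ : Measurable φ) (hψ : LocallyIntegrable ψ volume) (hp0 : p 0 ≠ 0)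
    (hpa : ∀ k, a k ≠ 0 → p k ≠ 0) (hpmean : ∑' k : ℕ, (k : ℝ≥0∞) * p k ≤ 1) :
    IsMildSolution F φ ψ (criticalTime p a φ ψ) (cascadeMean p a φ ψ) := by
  have hm := measurable_cascadeMean p a hφ hψ
  have hFm := (measurable_of_hasSum_pow hF).comp hm
  obtain ⟨C, hC⟩ := exists_bound_of_hasSum_pow hF zero_le_one
  refine ⟨hm.comp measurable_subtype_coe, fun z hz => ?_, fun z hz => ?_⟩
  · refine Measure.integrableOn_of_bounded (M := C) (volume_lightCone_ne_top z)
      hFm.aestronglyMeasurable ?_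
    refine (ae_restrict_iff' (measurableSet_lightCone z)).2 (ae_of_all _ fun q hq => ?_)
    exact hC _ (abs_cascadeMean_le_one (lightCone_subset_strip hz hq))
  · have hi : Integrable (fun θ => F (cascadeMean p a φ ψ (conePoint z θ)))
        (uniformCone (0, 1)) := by
      have hc : Measurable (conePoint z) := by unfold conePoint; fun_prop
      refine Integrable.of_bound (hFm.comp hc).aestronglyMeasurable C ?_
      filter_upwards [ae_uniformCone_mem (0, 1)] with θ hθ
      exact hC _ (abs_cascadeMean_le_one
        (lightCone_subset_strip hz (conePoint_mem_lightCone hz.1 hθ)))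
    rw [cascadeMean_eq_integral hF hφ hψ hp0 hpa hpmean hz,
      integral_add (integrable_const _) (hi.const_mul _), integral_const_mul,
      ← integral_comp_conePoint (f := fun q => F (cascadeMean p a φ ψ q)) hFm hz.1]
    simp only [integral_const, probReal_univ, one_smul]
    ring

end Mean

/-! ### Uniqueness of mild solutions -/

section Uniqueness

/-- Enclosing the cone in a rectangle is crude but keeps the factor `1 / c`, which drives the
contraction. -/
lemma integral_lightCone_exp_le {c : ℝ} (hc : 0 < c) {q : ℝ × ℝ} (hq : 0 ≤ q.2) :
    ∫ r in lightCone q, Real.exp (c * r.2) ≤ 2 * q.2 * (Real.exp (c * q.2) / c) := by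
  have hsub : lightCone q ⊆ Set.Icc (q.1 - q.2) (q.1 + q.2) ×ˢ Set.Icc 0 q.2 := by
    rintro ⟨y, s⟩ ⟨h1, h2, h3⟩
    simp only at h1 h2 h3
    rw [abs_le] at h3
    refine ⟨⟨?_, ?_⟩, ?_, ?_⟩ <;> simp only <;> linarith [h3.1, h3.2]
  have hcont : Continuous fun r : ℝ × ℝ => Real.exp (c * r.2) := by fun_prop
  have hint : IntegrableOn (fun r : ℝ × ℝ => Real.exp (c * r.2))
      (Set.Icc (q.1 - q.2) (q.1 + q.2) ×ˢ Set.Icc 0 q.2) :=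
    hcont.continuousOn.integrableOn_compact (isCompact_Icc.prod isCompact_Icc)
  refine (setIntegral_mono_set hint (ae_of_all _ fun r => (Real.exp_pos _).le)
    hsub.eventuallyLE).trans ?_
  have h := setIntegral_prod_mul (μ := (volume : Measure ℝ)) (ν := (volume : Measure ℝ))
    (fun _ => (1 : ℝ)) (fun s => Real.exp (c * s)) (Set.Icc (q.1 - q.2) (q.1 + q.2))
    (Set.Icc 0 q.2)
  simp only [one_mul] at h
  rw [Measure.volume_eq_prod, h, integral_Icc_eq_integral_Ioc (x := 0),
    ← intervalIntegral.integral_of_le hq,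
    intervalIntegral.integral_comp_mul_left _ hc.ne', integral_exp]
  have hlen : q.1 + q.2 - (q.1 - q.2) = 2 * q.2 := by ring
  simp only [setIntegral_const, Real.volume_real_Icc, hlen, smul_eq_mul, mul_one,
    max_eq_left (show 0 ≤ 2 * q.2 by linarith), mul_zero, Real.exp_zero]
  refine mul_le_mul_of_nonneg_left ?_ (by linarith)
  rw [inv_mul_eq_div]
  gcongr
  linarith

variable {F φ ψ : ℝ → ℝ} {T : ℝ≥0∞} {u u₁ u₂ : ℝ × ℝ → ℝ} {z : ℝ × ℝ}

/-- A mild solution is bounded on every cone on which the linear part is. -/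
lemma IsMildSolution.exists_bound (hu : IsMildSolution F φ ψ T u) {C : ℝ}
    (hC : ∀ q ∈ strip T, |homSol φ ψ q| ≤ C) (hz : z ∈ strip T) :
    ∃ M, ∀ q ∈ lightCone z, |u q| ≤ M := by
  -- The integral over the cone of `z` dominates those over the cones of its points, which are
  -- contained in it.
  refine ⟨C + (1 / 2) * ∫ q in lightCone z, |F (u q)|, fun q hq => ?_⟩
  have hqT := lightCone_subset_strip hz hq
  rw [hu.eq q hqT]
  refine (abs_add_le _ _).trans (add_le_add (hC q hqT) ?_)
  rw [abs_mul, abs_of_pos (by norm_num : (0 : ℝ) < 1 / 2)]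
  refine mul_le_mul_of_nonneg_left ?_ (by norm_num)
  exact (abs_integral_le_integral_abs).trans (setIntegral_mono_set (hu.integrableOn z hz).abs
    (ae_of_all _ fun _ => abs_nonneg _) (lightCone_subset_lightCone hq).eventuallyLE)

/-- Uniqueness of mild solutions: a Gronwall argument on the cone of `z`. -/
lemma IsMildSolution.eq_of_lipschitz (h₁ : IsMildSolution F φ ψ T u₁)
    (h₂ : IsMildSolution F φ ψ T u₂) (hz : z ∈ strip T) {M L : ℝ} (hL0 : 0 ≤ L)
    (hM₁ : ∀ q ∈ lightCone z, |u₁ q| ≤ M) (hM₂ : ∀ q ∈ lightCone z, |u₂ q| ≤ M)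
    (hL : ∀ x y, |x| ≤ M → |y| ≤ M → |F x - F y| ≤ L * |x - y|) : u₁ z = u₂ z := by
  have hM : 0 ≤ M := (abs_nonneg _).trans (hM₁ z (self_mem_lightCone hz.1))
  -- Chosen so that `2 * q.2 * L / c ≤ 1` on the cone; the factor `1/2` of the integral equation
  -- then halves the error at each iteration. The `+ 1` keeps `c` positive when `z.2 * L = 0`.
  set c : ℝ := 2 * z.2 * L + 1
  have hz0 : 0 ≤ z.2 := hz.1
  have hc : 0 < c := by positivity
  have key : ∀ n : ℕ, ∀ q ∈ lightCone z,
      |u₁ q - u₂ q| ≤ 2 * M * (1 / 2) ^ n * Real.exp (c * q.2) := by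
    intro n
    induction n with
    | zero =>
      intro q hq
      have h1 : |u₁ q - u₂ q| ≤ 2 * M := by
        have := abs_sub (u₁ q) (u₂ q)
        linarith [hM₁ q hq, hM₂ q hq]
      have h2 : 1 ≤ Real.exp (c * q.2) := Real.one_le_exp (mul_nonneg hc.le hq.1)
      rw [pow_zero, mul_one]
      nlinarith
    | succ n ih =>
      intro q hq
      have hqT := lightCone_subset_strip hz hq
      have hi := (h₁.integrableOn q hqT).sub (h₂.integrableOn q hqT)
      set K : ℝ := 2 * M * (1 / 2) ^ n
      have hK : 0 ≤ K := by positivity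
      have hbound : |∫ r in lightCone q, (F (u₁ r) - F (u₂ r))|
          ≤ L * K * (2 * q.2 * (Real.exp (c * q.2) / c)) := by
        have hexp : IntegrableOn (fun r : ℝ × ℝ => Real.exp (c * r.2)) (lightCone q) := by
          refine Measure.integrableOn_of_bounded (M := Real.exp (c * q.2))
            (volume_lightCone_ne_top q)
            (by fun_prop : Continuous fun r : ℝ × ℝ => Real.exp (c * r.2)).aestronglyMeasurable
            ((ae_restrict_iff' (measurableSet_lightCone q)).2 (ae_of_all _ fun r hr => ?_))
          rw [Real.norm_eq_abs, Real.abs_exp]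
          exact Real.exp_le_exp.2 (mul_le_mul_of_nonneg_left hr.2.1 hc.le)
        calc |∫ r in lightCone q, (F (u₁ r) - F (u₂ r))|
            ≤ ∫ r in lightCone q, |F (u₁ r) - F (u₂ r)| := abs_integral_le_integral_abs
          _ ≤ ∫ r in lightCone q, L * K * Real.exp (c * r.2) := by
            refine setIntegral_mono_on hi.abs (hexp.const_mul _) (measurableSet_lightCone q)
              fun r hr => ?_
            have hr' := lightCone_subset_lightCone hq hr
            refine (hL _ _ (hM₁ r hr') (hM₂ r hr')).trans ?_
            rw [mul_assoc]
            exact mul_le_mul_of_nonneg_left (ih r hr') hL0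
          _ ≤ L * K * (2 * q.2 * (Real.exp (c * q.2) / c)) := by
            rw [integral_const_mul]
            exact mul_le_mul_of_nonneg_left (integral_lightCone_exp_le hc hq.1)
              (mul_nonneg hL0 hK)
      have hdiff : u₁ q - u₂ q = (1 / 2) * ∫ r in lightCone q, (F (u₁ r) - F (u₂ r)) := by
        rw [integral_sub (h₁.integrableOn q hqT) (h₂.integrableOn q hqT), h₁.eq q hqT,
          h₂.eq q hqT]
        ring
      rw [hdiff, abs_mul, abs_of_pos (by norm_num : (0 : ℝ) < 1 / 2)]
      have hratio : 2 * q.2 * L / c ≤ 1 := by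
        rw [div_le_one hc]
        have : q.2 * L ≤ z.2 * L := mul_le_mul_of_nonneg_right hq.2.1 hL0
        simp only [c]
        linarith
      calc (1 / 2) * |∫ r in lightCone q, (F (u₁ r) - F (u₂ r))|
          ≤ (1 / 2) * (L * K * (2 * q.2 * (Real.exp (c * q.2) / c))) :=
            mul_le_mul_of_nonneg_left hbound (by norm_num)
        _ = 2 * q.2 * L / c * (1 / 2 * K * Real.exp (c * q.2)) := by ring
        _ ≤ 1 * (1 / 2 * K * Real.exp (c * q.2)) :=
            mul_le_mul_of_nonneg_right hratio (by positivity)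
        _ = 2 * M * (1 / 2) ^ (n + 1) * Real.exp (c * q.2) := by
            simp only [K]
            ring
  have hlim : Filter.Tendsto (fun n : ℕ => 2 * M * (1 / 2) ^ n * Real.exp (c * z.2))
      Filter.atTop (nhds 0) := by
    have := ((tendsto_pow_atTop_nhds_zero_of_lt_one (r := (1 / 2 : ℝ)) (by norm_num)
      (by norm_num)).const_mul (2 * M)).mul_const (Real.exp (c * z.2))
    simpa using this
  have h0 : |u₁ z - u₂ z| ≤ 0 :=
    ge_of_tendsto' hlim fun n => key n z (self_mem_lightCone hz.1)
  exact sub_eq_zero.1 (abs_nonpos_iff.1 h0)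

end Uniqueness

end WaveCascade

end

theorem mainTheorem1
    (F : ℝ → ℝ) (a : ℕ → ℝ) (hF : ∀ u : ℝ, HasSum (fun k => a k * u ^ k) (F u))
    (φ ψ : ℝ → ℝ) (hφ : Measurable φ) (hψ : LocallyIntegrable ψ volume)
    (p : PMF ℕ) (hp0 : p 0 ≠ 0)
    (hpa : ∀ k, a k ≠ 0 → p k ≠ 0)
    (hpmean : ∑' k : ℕ, (k : ℝ≥0∞) * p k ≤ 1)
    (hT : 0 < WaveCascade.criticalTime p a φ ψ) :
    (∀ᵐ ω ∂(WaveCascade.cascadeLaw p), ω.tree.Finite) ∧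
    (∀ z ∈ WaveCascade.strip (WaveCascade.criticalTime p a φ ψ),
      Integrable (WaveCascade.cascadeProduct p a φ ψ z) (WaveCascade.cascadeLaw p)) ∧
    WaveCascade.IsMildSolution F φ ψ (WaveCascade.criticalTime p a φ ψ)
      (WaveCascade.cascadeMean p a φ ψ) ∧
    (∀ u : ℝ × ℝ → ℝ,
      WaveCascade.IsMildSolution F φ ψ (WaveCascade.criticalTime p a φ ψ) u →
      ∀ z ∈ WaveCascade.strip (WaveCascade.criticalTime p a φ ψ),
        u z = WaveCascade.cascadeMean p a φ ψ z) := by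
  refine ⟨WaveCascade.ae_finite_tree hpmean hp0,
    fun z hz => WaveCascade.integrable_cascadeProduct hφ hψ hz,
    WaveCascade.isMildSolution_cascadeMean hF hφ hψ hp0 hpa hpmean, fun u hu z hz => ?_⟩
  have hmean := WaveCascade.isMildSolution_cascadeMean hF hφ hψ hp0 hpa hpmean
  obtain ⟨M, hM⟩ := hu.exists_bound
    (fun q hq => WaveCascade.abs_homSol_le_one hp0 hq) hz
  -- The radius `max 1 M` bounds both `u` and the mean, and meets the requirement of being at least
  -- 1.
  obtain ⟨L, hL0, hL⟩ := WaveCascade.exists_lipschitz_of_hasSum_pow hF (le_max_left 1 M)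
  exact hu.eq_of_lipschitz hmean hz hL0 (fun q hq => (hM q hq).trans (le_max_right 1 M))
    (fun q hq => (WaveCascade.abs_cascadeMean_le_one
      (WaveCascade.lightCone_subset_strip hz hq)).trans (le_max_left 1 M)) hL
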